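/- Consider the infinite binary tree whose root is $1$ with a single child $1$, and in which every node $y$ with parent $x$ has the two children $|x-y|$ (left branch) and $x+y$ (right branch). A parent-child pair $(a,b)$ is at depth $N$ if it is reached from the top pair $(1,1)$ (depth $0$) by $N$ branches. For nonnegative integers $a,b$ with $\gcd(a,b)=1$, let $A_{(a,b)}(n)$ be the number of occurrences of the pair $(a,b)$ at depth $3n+m$, where $m=0$ if $a,b$ are odd, $m=1$ if $a$ is odd and $b$ is even, and $m=2$ if $a$ is even and $b$ is odd. Let $k$ be the number of branches in the shortest walk from the top pair $(1,1)$ to the pair $(a,b)$. For $j\ge 0$ put $$t_{3j}=2^{-j}\left(1+\tfrac{j}{3}\right),\qquad t_{3j+1}=2^{-j}\left(\tfrac53+\tfrac{j}{2}\right),\qquad t_{3j+2}=2^{-j}\left(\tfrac{11}{4}+\tfrac{3j}{4}\right),$$ and define rational numbers $s_k$ by $s_0=-\tfrac{1387}{72}$, $s_1=-\tfrac{7559}{360}$, $s_2=-\tfrac{18173}{792}$ and, for $k\ge 3$, $$s_k=\frac{t_{k-2}s_{k-2}-t_{k-3}s_{k-3}}{t_k}\ \text{ if } 3\nmid k+1,\qquad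 s_k=\frac{\tfrac{27}{4}\,t_{k-2}\left(s_{k-2}-\tfrac32\right)-t_{k-3}s_{k-3}}{t_k}\ \text{ if } 3\mid k+1 .$$ Theorem. For every pair $(a,b)$ of coprime nonnegative integers there are a real constant $C_{(a,b)}>0$ and a rational constant $D_{(a,b)}$ such that $$A_{(a,b)}(n)=\frac{C_{(a,b)}\cdot 6.75^n}{n^{3/2}}+\frac{C_{(a,b)}D_{(a,b)}\cdot 6.75^n}{n^{5/2}}+O\left(\frac{6.75^n}{n^{7/2}}\right)\qquad(n\ge 1),$$ where $6.75=\tfrac{27}{4}$ and the implied constant depends only on $k$. If $a$ and $b$ are both positive, then $$C_{(a,b)}=\frac{243\,t_k}{4\sqrt{3\pi}},\qquad D_{(a,b)}=s_k .$$ -/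

import Mathlib

namespace FibTree

/-- One branch below a parent-child pair `(x, y)`: the new pair is `(y, |x - y|)` for a left
branch (`false`) and `(y, x + y)` for a right branch (`true`). -/
def step (p : ℕ × ℕ) (right : Bool) : ℕ × ℕ :=
  if right then (p.2, p.1 + p.2) else (p.2, ((p.1 : ℤ) - (p.2 : ℤ)).natAbs)

/-- The parent-child pair reached from the pair `g` by following the branches listed in `w`. A
finite walk in the tree with root pair `g` (equivalently, a non-root node) is a list of branches. -/
def endPair (g : ℕ × ℕ) (w : List Bool) : ℕ × ℕ :=
  w.foldl step g

/-- The number of occurrences of the pair `p` at depth `N` in the tree with root `1` whose only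
child is `1`; the pair `(1, 1)` at the top has depth `0`. -/
noncomputable def pairCount (p : ℕ × ℕ) (N : ℕ) : ℕ :=
  {w : List Bool | w.length = N ∧ endPair (1, 1) w = p}.ncard

/-- The residue `m` mod `3` of the depths at which a coprime pair `(a, b)` can occur: `0` if `a`
and `b` are odd, `1` if `a` is odd and `b` is even, `2` if `a` is even and `b` is odd. -/
def depthResidue (a b : ℕ) : ℕ :=
  if Even a then 2 else if Even b then 1 else 0

/-- `A a b n` is the number of `(a, b)` pairs at depth `3 n + m`. -/
noncomputable def A (a b n : ℕ) : ℕ :=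
  pairCount (a, b) (3 * n + depthResidue a b)

/-- The number of branches in a shortest walk from a pair `p` to a pair `q`. -/
noncomputable def shortestWalk (p q : ℕ × ℕ) : ℕ :=
  sInf {l : ℕ | ∃ w : List Bool, w.length = l ∧ endPair p w = q}

/-- The numbers `t_k`: with `j = ⌊k / 3⌋`, they are `2⁻ʲ (1 + j/3)`, `2⁻ʲ (5/3 + j/2)`,
`2⁻ʲ (11/4 + 3j/4)` for `k = 3j`, `3j + 1`, `3j + 2` respectively. -/
def t (k : ℕ) : ℚ :=
  if k % 3 = 0 then (1 / 2) ^ (k / 3) * (1 + ((k / 3 : ℕ) : ℚ) / 3)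
  else if k % 3 = 1 then (1 / 2) ^ (k / 3) * (5 / 3 + ((k / 3 : ℕ) : ℚ) / 2)
  else (1 / 2) ^ (k / 3) * (11 / 4 + 3 * ((k / 3 : ℕ) : ℚ) / 4)

/-- The relative second-order coefficients `s_k`, computed by recursion on `k`. -/
def s : ℕ → ℚ
  | 0 => -1387 / 72
  | 1 => -7559 / 360
  | 2 => -18173 / 792
  | k + 3 =>
    if (k + 3) % 3 = 2 then
      (27 / 4 * t (k + 1) * (s (k + 1) - 3 / 2) - t k * s k) / t (k + 3)
    else
      (t (k + 1) * s (k + 1) - t k * s k) / t (k + 3)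

end FibTree

/-! Read branches backwards. A positive coprime pair built from (1,1) by moves `R` (cost 1) and `RL`
(cost 2) of total cost k ≥ 1 has exactly two predecessors, of costs k - 1 and k + 2. The top pair is
preceded by (2,1), of cost 2, and, round the cycle (1,1), (1,0), (0,1), (1,1), by itself three
branches earlier with multiplicity four. Hence walk counts depend only on k and the length. If T = 1
+ x T^3, the count at length 3n + k is the coefficient of x^n in T^(k+3) / (2 - T)^2
(`pairCount_eq_walkCount`).

The branch of T with T(0) = 1 only reaches 3/2 at its singularity x = 4/27, so 2 - T does not vanish
there and the growth rate is 27/4. This is exploited by real-variable means. Since T^3 (1 - 8x) = (2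
- T)(4 - 2T - T^2), multiplying by 1 - 8x lowers the order of the pole, so the coefficients satisfy
f(n+1) = 8 f(n) - h(n) with h simpler. The bound O((27/4)^n) rules out the 8^n solutions, leaving
f(n) = Σ h(n+m) / 8^(m+1), which inherits a two-term expansion from h
(`WeightedExpands.of_recurrence`).

The coefficients of T^3 have a closed form: Stirling gives their leading constant and two monotone
sequences the next term (`ternary_three_expands`). Two applications of the transfer settle k = 0,
the cases k = 1, 2 are linear combinations, and the predecessor recurrence then produces `t` and `s`
for every k. -/

namespace FibTree

/-! ### Counting walks by their last branch -/

/-- The number of walks of length `N` from `(1, 1)` whose final pair satisfies `Q`. -/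
noncomputable def endCount (Q : ℕ × ℕ → Prop) (N : ℕ) : ℕ :=
  {w : List Bool | w.length = N ∧ Q (endPair (1, 1) w)}.ncard

lemma finite_walks (Q : ℕ × ℕ → Prop) (N : ℕ) :
    {w : List Bool | w.length = N ∧ Q (endPair (1, 1) w)}.Finite :=
  (List.finite_length_eq Bool N).subset fun _ h => h.1

lemma endCount_eq (q : ℕ × ℕ) (N : ℕ) : endCount (fun e => e = q) N = pairCount q N := rfl

lemma endCount_congr {Q Q' : ℕ × ℕ → Prop} (h : ∀ e, Q e ↔ Q' e) (N : ℕ) :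
    endCount Q N = endCount Q' N := by
  rw [show Q = Q' from funext fun e => propext (h e)]

lemma endCount_false (N : ℕ) : endCount (fun _ => False) N = 0 := by
  simp [endCount]

lemma endCount_or {Q Q' : ℕ × ℕ → Prop} (h : ∀ e, Q e → ¬ Q' e) (N : ℕ) :
    endCount (fun e => Q e ∨ Q' e) N = endCount Q N + endCount Q' N := by
  unfold endCount
  rw [← Set.ncard_union_eq _ (finite_walks Q N) (finite_walks Q' N)]
  · congr 1
    ext w
    simp only [Set.mem_ofPred_eq, Set.mem_union]
    tauto
  · rw [Set.disjoint_left]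
    exact fun w hw hw' => h _ hw.2 hw'.2

lemma endCount_succ (Q : ℕ × ℕ → Prop) (N : ℕ) :
    endCount Q (N + 1) =
      endCount (fun e => Q (step e false)) N + endCount (fun e => Q (step e true)) N := by
  have inj : ∀ r : Bool, Function.Injective fun w : List Bool => w ++ [r] :=
    fun r w w' h => List.append_cancel_right h
  unfold endCount
  rw [← Set.ncard_image_of_injective {w | w.length = N ∧ Q (step (endPair (1, 1) w) false)}
      (inj false),
    ← Set.ncard_image_of_injective {w | w.length = N ∧ Q (step (endPair (1, 1) w) true)} (inj true),
    ← Set.ncard_union_eq _ ((finite_walks (fun e => Q (step e false)) N).image _)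
      ((finite_walks (fun e => Q (step e true)) N).image _)]
  · congr 1
    ext w
    simp only [Set.mem_ofPred_eq, Set.mem_union, Set.mem_image]
    constructor
    · rintro ⟨hl, hQ⟩
      obtain ⟨w', r, rfl⟩ := List.eq_nil_or_concat w |>.resolve_left (by rintro rfl; simp at hl)
      simp only [List.concat_eq_append, List.length_append, List.length_cons, List.length_nil,
        zero_add, Nat.add_right_cancel_iff] at hl
      simp only [endPair, List.concat_eq_append, List.foldl_append, List.foldl_cons,
        List.foldl_nil] at hQ
      cases r
      · exact Or.inl ⟨w', ⟨hl, hQ⟩, by simp⟩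
      · exact Or.inr ⟨w', ⟨hl, hQ⟩, by simp⟩
    · rintro (⟨w', ⟨hl, hQ⟩, rfl⟩ | ⟨w', ⟨hl, hQ⟩, rfl⟩)
      · exact ⟨by simp [hl], by simpa [endPair] using hQ⟩
      · exact ⟨by simp [hl], by simpa [endPair] using hQ⟩
  · rw [Set.disjoint_left]
    rintro w ⟨w₁, -, rfl⟩ ⟨w₂, -, h⟩
    simpa using congrArg List.getLast? h

lemma pairCount_zero (q : ℕ × ℕ) : pairCount q 0 = if q = (1, 1) then 1 else 0 := by
  unfold pairCount
  split_ifs with h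
  · rw [Set.ncard_eq_one]
    refine ⟨[], ?_⟩
    ext w
    simp only [Set.mem_ofPred_eq, List.length_eq_zero_iff, Set.mem_singleton_iff]
    exact ⟨fun h => h.1, by rintro rfl; exact ⟨rfl, h.symm⟩⟩
  · rw [Set.ncard_eq_zero ((List.finite_length_eq Bool 0).subset fun _ h => h.1)]
    ext w
    simp only [Set.mem_ofPred_eq, List.length_eq_zero_iff, Set.mem_empty_iff_false, iff_false]
    rintro ⟨rfl, h'⟩
    exact h h'.symm

lemma pairCount_succ (q : ℕ × ℕ) (N : ℕ) :
    pairCount q (N + 1) =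
      endCount (fun e => step e false = q) N + endCount (fun e => step e true = q) N :=
  endCount_succ (fun e => e = q) N

lemma step_true_iff (x y b c : ℕ) : step (x, y) true = (b, c) ↔ y = b ∧ x + y = c := by
  simp [step]

lemma step_false_iff (x y b c : ℕ) :
    step (x, y) false = (b, c) ↔ y = b ∧ (x = y + c ∨ x + c = y) := by
  simp only [step, Bool.false_eq_true, if_false, Prod.mk.injEq]
  omega

lemma pairCount_right {a b : ℕ} (ha : 0 < a) (N : ℕ) :
    pairCount (b, a + b) (N + 1) = pairCount (a, b) N + pairCount (b + (a + b), b) N := by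
  have hL : ∀ e, step e false = (b, a + b) ↔ e = (b + (a + b), b) := by
    rintro ⟨x, y⟩; rw [step_false_iff, Prod.mk.injEq]; omega
  have hR : ∀ e, step e true = (b, a + b) ↔ e = (a, b) := by
    rintro ⟨x, y⟩; rw [step_true_iff, Prod.mk.injEq]; omega
  rw [pairCount_succ, endCount_congr hL, endCount_congr hR, add_comm, endCount_eq, endCount_eq]

lemma pairCount_left {a b : ℕ} (ha : 0 < a) (hb : 0 < b) (N : ℕ) :
    pairCount (a + b, a) (N + 1) =
      pairCount (b, a + b) N + pairCount (a + b + a, a + b) N := by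
  have hL : ∀ e, step e false = (a + b, a) ↔ e = (b, a + b) ∨ e = (a + b + a, a + b) := by
    rintro ⟨x, y⟩; rw [step_false_iff, Prod.mk.injEq, Prod.mk.injEq]; omega
  have hR : ∀ e, step e true = (a + b, a) ↔ False := by
    rintro ⟨x, y⟩; rw [step_true_iff, iff_false]; omega
  rw [pairCount_succ, endCount_congr hL, endCount_congr hR, endCount_false, add_zero,
    endCount_or, endCount_eq, endCount_eq]
  rintro _ rfl
  rw [Prod.mk.injEq]
  omega

/-- Both branches below (0,1) give (1,1), hence the factor 2. -/
lemma pairCount_one_one (N : ℕ) :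
    pairCount (1, 1) (N + 1) = 2 * pairCount (0, 1) N + pairCount (2, 1) N := by
  have hL : ∀ e, step e false = (1, 1) ↔ e = (0, 1) ∨ e = (2, 1) := by
    rintro ⟨x, y⟩; rw [step_false_iff, Prod.mk.injEq, Prod.mk.injEq]; omega
  have hR : ∀ e, step e true = (1, 1) ↔ e = (0, 1) := by
    rintro ⟨x, y⟩; rw [step_true_iff, Prod.mk.injEq]; omega
  rw [pairCount_succ, endCount_congr hL, endCount_congr hR, endCount_or, endCount_eq, endCount_eq]
  · ring
  · rintro _ rfl
    simp

lemma pairCount_one_zero (N : ℕ) : pairCount (1, 0) (N + 1) = pairCount (1, 1) N := by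
  have hL : ∀ e, step e false = (1, 0) ↔ e = (1, 1) := by
    rintro ⟨x, y⟩; rw [step_false_iff, Prod.mk.injEq]; omega
  have hR : ∀ e, step e true = (1, 0) ↔ False := by
    rintro ⟨x, y⟩; rw [step_true_iff, iff_false]; omega
  rw [pairCount_succ, endCount_congr hL, endCount_congr hR, endCount_false, endCount_eq, add_zero]

lemma pairCount_zero_one (N : ℕ) : pairCount (0, 1) (N + 1) = 2 * pairCount (1, 0) N := by
  have hL : ∀ e, step e false = (0, 1) ↔ e = (1, 0) := by
    rintro ⟨x, y⟩; rw [step_false_iff, Prod.mk.injEq]; omega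
  have hR : ∀ e, step e true = (0, 1) ↔ e = (1, 0) := by
    rintro ⟨x, y⟩; rw [step_true_iff, Prod.mk.injEq]; omega
  rw [pairCount_succ, endCount_congr hL, endCount_congr hR, endCount_eq, two_mul]

/-! ### The reduced tree of positive coprime pairs -/

/-- `AtDepth p k`: the pair `p` is reached from `(1, 1)` by `k` branches when only the branches
`R` and `RL` are used as moves. -/
inductive AtDepth : ℕ × ℕ → ℕ → Prop
  | root : AtDepth (1, 1) 0
  | right {a b k : ℕ} : AtDepth (a, b) k → AtDepth (b, a + b) (k + 1)
  | rightLeft {a b k : ℕ} : AtDepth (a, b) k → AtDepth (a + b, a) (k + 2)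

lemma AtDepth.pos {p : ℕ × ℕ} {k : ℕ} (h : AtDepth p k) : 0 < p.1 ∧ 0 < p.2 := by
  induction h <;> simp_all

/-- A right branch permutes the three parity patterns cyclically, and `RL` moves two places along
the same cycle. -/
lemma AtDepth.mod_three {p : ℕ × ℕ} {k : ℕ} (h : AtDepth p k) :
    depthResidue p.1 p.2 = k % 3 ∧ ¬ (Even p.1 ∧ Even p.2) := by
  induction h with
  | root => simp [depthResidue]
  | right _ ih =>
    simp only [depthResidue, Nat.even_add] at *
    split_ifs at * <;> simp_all <;> omega
  | rightLeft _ ih =>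
    simp only [depthResidue, Nat.even_add] at *
    split_ifs at * <;> simp_all <;> omega

/-- Subtractive Euclidean algorithm: undo `R` when a < b and `RL` when a > b. -/
lemma exists_atDepth {a b : ℕ} (ha : 0 < a) (hb : 0 < b) (h : Nat.Coprime a b) :
    ∃ k, AtDepth (a, b) k := by
  induction hn : a + b using Nat.strong_induction_on generalizing a b with
  | _ n ih =>
    subst hn
    rcases lt_trichotomy a b with hab | rfl | hab
    · obtain ⟨c, rfl⟩ := Nat.exists_eq_add_of_lt hab
      obtain ⟨k, hk⟩ := ih (c + 1 + a) (by omega) (a := c + 1) (b := a) (by omega) ha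
        (by rw [Nat.coprime_comm]; simpa [add_assoc] using h) rfl
      exact ⟨k + 1, by have := hk.right; rwa [show c + 1 + a = a + c + 1 by ring] at this⟩
    · rw [Nat.coprime_self] at h
      subst h
      exact ⟨0, .root⟩
    · obtain ⟨c, rfl⟩ := Nat.exists_eq_add_of_lt hab
      obtain ⟨k, hk⟩ := ih (b + (c + 1)) (by omega) (a := b) (b := c + 1) hb (by omega)
        (by rw [Nat.coprime_comm]; simpa [add_assoc] using h) rfl
      exact ⟨k + 2, by have := hk.rightLeft; rwa [← add_assoc] at this⟩

end FibTree

/-! ### Coefficients of T^(k+3) / (2 - T) and T^(k+3) / (2 - T)^2 -/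

namespace FibTree
open Finset

/-- The coefficient of `x ^ n` in `T ^ k`, where `T = 1 + x T ^ 3`. -/
noncomputable def ternary (k : ℕ) : ℕ → ℝ
  | 0 => 1
  | n + 1 => ((3 * n + 3 + k).choose (n + 1) : ℝ) - 3 * ((3 * n + 2 + k).choose n : ℝ)

/-- This is T^(k+1) = T^k + x T^(k+3), obtained from Pascal's rule on both binomials. -/
lemma ternary_succ (k n : ℕ) :
    ternary (k + 1) (n + 1) = ternary k (n + 1) + ternary (k + 3) n := by
  cases n with
  | zero => simp [ternary]
  | succ n =>
    have h1 := Nat.choose_succ_succ (3 * n + 6 + k) (n + 1)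
    have h2 := Nat.choose_succ_succ (3 * n + 5 + k) n
    simp only [ternary, Nat.succ_eq_add_one] at *
    rw [show 3 * (n + 1) + 3 + (k + 1) = 3 * n + 6 + k + 1 by ring,
      show 3 * (n + 1) + 2 + (k + 1) = 3 * n + 5 + k + 1 by ring,
      show 3 * (n + 1) + 3 + k = 3 * n + 6 + k by ring,
      show 3 * (n + 1) + 2 + k = 3 * n + 5 + k by ring,
      show 3 * n + 3 + (k + 3) = 3 * n + 6 + k by ring,
      show 3 * n + 2 + (k + 3) = 3 * n + 5 + k by ring, h1, h2]
    push_cast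
    ring

lemma ternary_zero_succ (n : ℕ) : ternary 0 (n + 1) = 0 := by
  have h := Nat.add_one_mul_choose_eq (3 * n + 2) n
  have h' : (3 * n + 2 + 1 : ℝ) * ((3 * n + 2).choose n : ℝ) =
      ((3 * n + 3).choose (n + 1) : ℝ) * (n + 1) := by exact_mod_cast h
  have hn : (n + 1 : ℝ) ≠ 0 := by positivity
  simp only [ternary, add_zero]
  refine (mul_eq_zero_iff_right hn).1 ?_
  linear_combination -h'

lemma ternary_three_succ (n : ℕ) :
    ternary 3 (n + 1) = ternary 3 n + ternary 4 n + ternary 5 n := by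
  rw [ternary_succ 2, ternary_succ 1, ternary_succ 0, ternary_zero_succ]
  ring

/-- The coefficient of `x ^ n` in `T ^ (k + 3) / (2 - T)`. -/
noncomputable def simplePole (k n : ℕ) : ℝ :=
  ∑ i ∈ range (n + 1), ternary (3 * i + k + 3) (n - i)

/-- The coefficient of `x ^ n` in `T ^ (k + 3) / (2 - T) ^ 2`. -/
noncomputable def doublePole (k n : ℕ) : ℝ :=
  ∑ i ∈ range (n + 1), (i + 1) * ternary (3 * i + k + 3) (n - i)

lemma simplePole_zero (k : ℕ) : simplePole k 0 = 1 := by simp [simplePole, ternary]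

lemma doublePole_zero (k : ℕ) : doublePole k 0 = 1 := by simp [doublePole, ternary]

/-- Since 2 - T = 1 - x T^3, the defining sum is a geometric series; its first term is split off. -/
lemma simplePole_succ_right (k n : ℕ) :
    simplePole k (n + 1) = ternary (k + 3) (n + 1) + simplePole (k + 3) n := by
  rw [simplePole, sum_range_succ', simplePole, add_comm]
  congr 1
  · simp
  · refine sum_congr rfl fun i _ => ?_
    rw [Nat.add_sub_add_right]
    congr 1
    ring

lemma doublePole_succ_right (k n : ℕ) :
    doublePole k (n + 1) = simplePole k (n + 1) + doublePole (k + 3) n := by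
  rw [simplePole_succ_right, doublePole, sum_range_succ', doublePole, simplePole,
    add_assoc (ternary (k + 3) (n + 1)), ← sum_add_distrib, add_comm]
  congr 1
  · simp
  · refine sum_congr rfl fun i _ => ?_
    rw [Nat.add_sub_add_right, show 3 * (i + 1) + k + 3 = 3 * i + (k + 3) + 3 by ring]
    push_cast
    ring

lemma sum_ternary_succ (c : ℕ → ℝ) (k n : ℕ) :
    ∑ i ∈ range (n + 2), c i * ternary (3 * i + (k + 1) + 3) (n + 1 - i) =
      ∑ i ∈ range (n + 2), c i * ternary (3 * i + k + 3) (n + 1 - i) +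
        ∑ i ∈ range (n + 1), c i * ternary (3 * i + (k + 3) + 3) (n - i) := by
  rw [sum_range_succ, sum_range_succ (n := n + 1),
    add_right_comm (∑ x ∈ range (n + 1), c x * ternary (3 * x + k + 3) (n + 1 - x)), ← sum_add_distrib]
  congr 1
  · refine sum_congr rfl fun i hi => ?_
    rw [mem_range] at hi
    rw [show n + 1 - i = n - i + 1 by omega, show 3 * i + (k + 1) + 3 = 3 * i + k + 3 + 1 by ring,
      ternary_succ, show 3 * i + k + 3 + 3 = 3 * i + (k + 3) + 3 by ring]
    ring
  · simp [ternary]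

lemma simplePole_succ_succ (k n : ℕ) :
    simplePole (k + 1) (n + 1) = simplePole k (n + 1) + simplePole (k + 3) n := by
  simpa [simplePole] using sum_ternary_succ (fun _ => 1) k n

lemma doublePole_succ_succ (k n : ℕ) :
    doublePole (k + 1) (n + 1) = doublePole k (n + 1) + doublePole (k + 3) n :=
  sum_ternary_succ (fun i => i + 1) k n

lemma simplePole_succ_left (k n : ℕ) :
    simplePole (k + 1) n = 2 * simplePole k n - ternary (k + 3) n := by
  cases n with
  | zero => simp only [simplePole_zero, ternary]; ring
  | succ n => linarith [simplePole_succ_succ k n, simplePole_succ_right k n]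

lemma doublePole_succ_left (k n : ℕ) :
    doublePole (k + 1) n = 2 * doublePole k n - simplePole k n := by
  cases n with
  | zero => simp only [simplePole_zero, doublePole_zero]; ring
  | succ n => linarith [doublePole_succ_succ k n, doublePole_succ_right k n]

/-- The factor 8 is 1/x at T = 2: multiplication by 1 - 8x cancels the simple pole. -/
lemma simplePole_zero_succ (n : ℕ) :
    simplePole 0 (n + 1) = 8 * simplePole 0 n - 3 * ternary 3 n - ternary 4 n := by
  linarith [simplePole_succ_right 0 n, simplePole_succ_left 0 n, simplePole_succ_left 1 n,
    simplePole_succ_left 2 n, ternary_three_succ n]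

lemma doublePole_zero_succ (n : ℕ) :
    doublePole 0 (n + 1) = 8 * doublePole 0 n - 4 * simplePole 0 n + ternary 3 n := by
  linarith [doublePole_succ_right 0 n, doublePole_succ_left 0 n, doublePole_succ_left 1 n,
    doublePole_succ_left 2 n, simplePole_succ_left 0 n, simplePole_succ_left 1 n,
    simplePole_zero_succ n]

lemma doublePole_one (n : ℕ) : doublePole 1 n = 2 * doublePole 0 n - simplePole 0 n :=
  doublePole_succ_left 0 n

lemma doublePole_two (n : ℕ) :
    doublePole 2 n = 4 * doublePole 0 n - 4 * simplePole 0 n + ternary 3 n := by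
  linarith [doublePole_succ_left 0 n, doublePole_succ_left 1 n, simplePole_succ_left 0 n]

lemma doublePole_zero_succ' (n : ℕ) :
    doublePole 0 (n + 1) = 4 * doublePole 0 n + doublePole 2 n := by
  linarith [doublePole_zero_succ n, doublePole_two n]

/-- The recurrences have nonnegative coefficients, and the majorant comes from x = 4/27, T = 3/2: it
satisfies the recurrence in k exactly, and the boundary one because 4 + (3/2)^2 ≤ 27/4. -/
lemma doublePole_bounds (n k : ℕ) :
    0 ≤ doublePole k n ∧ doublePole k n ≤ (27 / 4) ^ n * (3 / 2) ^ k := by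
  induction n generalizing k with
  | zero =>
    rw [doublePole_zero]
    exact ⟨zero_le_one, by simpa using one_le_pow₀ (by norm_num : (1 : ℝ) ≤ 3 / 2)⟩
  | succ n ih =>
    induction k with
    | zero =>
      rw [doublePole_zero_succ']
      have h0 := ih 0
      have h2 := ih 2
      have hp : (0 : ℝ) < (27 / 4) ^ n := by positivity
      rw [pow_succ]
      constructor <;> linarith
    | succ k ihk =>
      rw [doublePole_succ_succ]
      have h := ih (k + 3)
      refine ⟨add_nonneg ihk.1 h.1, (add_le_add ihk.2 h.2).trans (le_of_eq ?_)⟩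
      ring

/-! ### Walk counts as coefficients -/

/-- The number of walks of length `N` from `(1, 1)` to a pair at depth `k`. -/
noncomputable def walkCount (k N : ℕ) : ℝ :=
  if k ≤ N ∧ N % 3 = k % 3 then doublePole k ((N - k) / 3) else 0

lemma walkCount_add (k n : ℕ) : walkCount k (3 * n + k) = doublePole k n := by
  rw [walkCount, if_pos ⟨by omega, by omega⟩]
  congr 1
  omega

lemma walkCount_eq_zero {k N : ℕ} (h : ¬ (k ≤ N ∧ N % 3 = k % 3)) : walkCount k N = 0 :=
  if_neg h

lemma walkCount_succ (k N : ℕ) :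
    walkCount (k + 1) (N + 1) = walkCount k N + walkCount (k + 3) N := by
  by_cases h : k ≤ N ∧ N % 3 = k % 3
  · obtain ⟨n, rfl⟩ : ∃ n, N = 3 * n + k := ⟨(N - k) / 3, by omega⟩
    rw [add_assoc, walkCount_add, walkCount_add]
    cases n with
    | zero => rw [walkCount_eq_zero (by omega), doublePole_zero, doublePole_zero, add_zero]
    | succ n =>
      rw [show 3 * (n + 1) + k = 3 * n + (k + 3) by ring, walkCount_add, doublePole_succ_succ]
  · rw [walkCount_eq_zero, walkCount_eq_zero h, walkCount_eq_zero, add_zero] <;> omega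

lemma walkCount_zero_succ (N : ℕ) :
    walkCount 0 (N + 3) = 4 * walkCount 0 N + walkCount 2 (N + 2) := by
  by_cases h : N % 3 = 0
  · obtain ⟨n, rfl⟩ : ∃ n, N = 3 * n := ⟨N / 3, by omega⟩
    rw [walkCount_add, show walkCount 0 (3 * n) = _ from walkCount_add 0 n,
      ← doublePole_zero_succ', ← walkCount_add 0 (n + 1)]
    congr 1
  · rw [walkCount_eq_zero, walkCount_eq_zero, walkCount_eq_zero] <;> first | omega | simp

end FibTree

namespace FibTree

/-- Both sides obey the same predecessor recurrences; strong induction is needed because the cycle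
through (1,0) and (0,1) goes back three branches. -/
lemma pairCount_eq_walkCount (N : ℕ) {p : ℕ × ℕ} {k : ℕ} (h : AtDepth p k) :
    (pairCount p N : ℝ) = walkCount k N := by
  induction N using Nat.strong_induction_on generalizing p k with
  | _ N ih =>
    cases N with
    | zero =>
      rw [pairCount_zero]
      cases h with
      | root => simpa using (doublePole_zero 0).symm.trans (walkCount_add 0 0).symm
      | right h =>
        have := h.pos
        rw [if_neg (by simp only [Prod.mk.injEq] at *; omega), walkCount_eq_zero (by omega),
          Nat.cast_zero]
      | rightLeft h =>
        have := h.pos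
        rw [if_neg (by simp only [Prod.mk.injEq] at *; omega), walkCount_eq_zero (by omega),
          Nat.cast_zero]
    | succ N =>
      cases h with
      | root =>
        have h2 : (pairCount (2, 1) N : ℝ) = walkCount 2 N :=
          ih N (by omega) AtDepth.root.rightLeft
        rw [pairCount_one_one]
        push_cast
        rw [h2]
        match N with
        | 0 =>
          rw [pairCount_zero, walkCount_eq_zero (by omega), walkCount_eq_zero (by omega)]
          simp
        | 1 =>
          rw [pairCount_zero_one, pairCount_zero, walkCount_eq_zero (by omega),
            walkCount_eq_zero (by omega)]
          simp
        | N + 2 =>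
          rw [pairCount_zero_one, pairCount_one_zero, walkCount_zero_succ,
            ← ih N (by omega) AtDepth.root]
          push_cast
          ring
      | @right a b k h =>
        rw [pairCount_right h.pos.1, walkCount_succ, ← ih N (by omega) h,
          ← ih N (by omega) h.right.rightLeft]
        push_cast
        rfl
      | @rightLeft a b k h =>
        rw [pairCount_left h.pos.1 h.pos.2, walkCount_succ, ← ih N (by omega) h.right,
          ← ih N (by omega) h.rightLeft.rightLeft]
        push_cast
        rfl

lemma shortestWalk_eq {p : ℕ × ℕ} {k : ℕ} (h : AtDepth p k) : shortestWalk (1, 1) p = k := by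
  have key : ∀ l, (∃ w : List Bool, w.length = l ∧ endPair (1, 1) w = p) ↔
      walkCount k l ≠ 0 := by
    intro l
    rw [← pairCount_eq_walkCount l h, Nat.cast_ne_zero, pairCount, ← Nat.pos_iff_ne_zero,
      Set.ncard_pos (finite_walks (fun e => e = p) l)]
    rfl
  have hk : walkCount k k ≠ 0 := by
    have := walkCount_add k 0
    rw [doublePole_zero, mul_zero, zero_add] at this
    rw [this]
    exact one_ne_zero
  refine le_antisymm (Nat.sInf_le ((key k).2 hk)) ?_
  refine le_csInf ⟨k, (key k).2 hk⟩ fun l hl => ?_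
  by_contra hlt
  exact (key l).1 hl (walkCount_eq_zero (by omega))

/-- The number of walks of length `3 n + m` to a pair at depth `k`, where `m` is `k` mod `3`. -/
noncomputable def alignedCount (k n : ℕ) : ℝ := walkCount k (3 * n + k % 3)

lemma A_eq_alignedCount {a b k : ℕ} (h : AtDepth (a, b) k) (n : ℕ) :
    (A a b n : ℝ) = alignedCount k n := by
  rw [A, pairCount_eq_walkCount _ h, h.mod_three.1, alignedCount]

lemma alignedCount_of_lt {k : ℕ} (hk : k < 3) (n : ℕ) : alignedCount k n = doublePole k n := by
  rw [alignedCount, Nat.mod_eq_of_lt hk, walkCount_add]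

/-- The predecessor recurrence solved for its deepest term. The index moves to n + 1 exactly when
passing from k to k + 1 wraps the residue mod 3. -/
lemma alignedCount_add_three (k n : ℕ) :
    alignedCount (k + 3) n =
      alignedCount (k + 1) (if k % 3 = 2 then n + 1 else n) - alignedCount k n := by
  have h := walkCount_succ k (3 * n + k % 3)
  have e : 3 * n + k % 3 + 1 =
      3 * (if k % 3 = 2 then n + 1 else n) + (k + 1) % 3 := by split_ifs <;> omega
  rw [e] at h
  rw [alignedCount, alignedCount, alignedCount, h, Nat.add_mod_right]
  ring

lemma A_one_zero (n : ℕ) : (A 1 0 n : ℝ) = doublePole 0 n := by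
  have h : A 1 0 n = pairCount (1, 0) (3 * n + 1) := by simp [A, depthResidue]
  rw [h, pairCount_one_zero, pairCount_eq_walkCount _ AtDepth.root]
  exact walkCount_add 0 n

lemma A_zero_one (n : ℕ) : (A 0 1 n : ℝ) = 2 * doublePole 0 n := by
  have h : A 0 1 n = pairCount (0, 1) (3 * n + 1 + 1) := by simp [A, depthResidue]
  rw [h, pairCount_zero_one, pairCount_one_zero]
  push_cast
  rw [pairCount_eq_walkCount _ AtDepth.root, show walkCount 0 (3 * n) = _ from walkCount_add 0 n]

end FibTree

/-! ### Calculus of two-term asymptotic expansions -/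

namespace FibTree
open Filter Asymptotics Topology

/-- `r n = a + b / n + O(1 / n ^ 2)`. -/
def Expands (r : ℕ → ℝ) (a b : ℝ) : Prop :=
  (fun n : ℕ => r n - (a + b / n)) =O[atTop] fun n : ℕ => ((n : ℝ) ^ 2)⁻¹

namespace Expands

variable {r s : ℕ → ℝ} {a b c d : ℝ}

lemma congr' (h : Expands r a b) (hs : r =ᶠ[atTop] s) : Expands s a b :=
  IsBigO.congr' h (hs.mono fun n hn => by simp only [hn]) EventuallyEq.rfl

lemma linear (a b : ℝ) : Expands (fun n => a + b / n) a b := by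
  simpa [Expands] using isBigO_zero _ _

lemma of_isBigO (h : (fun n => r n - s n) =O[atTop] fun n : ℕ => ((n : ℝ) ^ 2)⁻¹)
    (hs : Expands s a b) : Expands r a b :=
  (h.add hs).congr_left fun n => by ring

lemma add (hr : Expands r a b) (hs : Expands s c d) :
    Expands (fun n => r n + s n) (a + c) (b + d) :=
  (IsBigO.add hr hs).congr_left fun n => by ring

lemma const_mul (hr : Expands r a b) (c : ℝ) : Expands (fun n => c * r n) (c * a) (c * b) :=
  (IsBigO.const_mul_left hr c).congr_left fun n => by ring

lemma sub (hr : Expands r a b) (hs : Expands s c d) :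
    Expands (fun n => r n - s n) (a - c) (b - d) :=
  (IsBigO.sub hr hs).congr_left fun n => by ring

lemma tendsto_linear (a b : ℝ) : Tendsto (fun n : ℕ => a + b / n) atTop (𝓝 a) := by
  simpa using tendsto_const_nhds.add (tendsto_const_div_atTop_nhds_zero_nat b)

lemma tendsto (hr : Expands r a b) : Tendsto r atTop (𝓝 a) := by
  have h0 : Tendsto (fun n : ℕ => ((n : ℝ) ^ 2)⁻¹) atTop (𝓝 0) :=
    tendsto_inv_atTop_zero.comp
      ((tendsto_pow_atTop two_ne_zero).comp tendsto_natCast_atTop_atTop)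
  simpa using (IsBigO.trans_tendsto hr h0).add (tendsto_linear a b)

lemma isBigO_one (hr : Expands r a b) : r =O[atTop] fun _ => (1 : ℝ) :=
  hr.tendsto.isBigO_one ℝ

lemma mul (hr : Expands r a b) (hs : Expands s c d) :
    Expands (fun n => r n * s n) (a * c) (a * d + b * c) := by
  have h1 := (IsBigO.mul hr hs.isBigO_one).congr_right fun n => mul_one _
  have h2 := ((linear a b).isBigO_one.mul hs).congr_right fun n => one_mul _
  have h3 : (fun n : ℕ => b * d * ((n : ℝ) ^ 2)⁻¹) =O[atTop] fun n : ℕ => ((n : ℝ) ^ 2)⁻¹ :=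
    (isBigO_refl _ _).const_mul_left _
  refine ((h1.add h2).add h3).congr_left fun n => ?_
  simp only [div_eq_mul_inv]
  ring

lemma inv (hr : Expands r a b) (ha : a ≠ 0) : Expands (fun n => (r n)⁻¹) a⁻¹ (-b / a ^ 2) := by
  have hl := hr.mul (linear a⁻¹ (-b / a ^ 2))
  rw [show a * a⁻¹ = 1 from mul_inv_cancel₀ ha,
    show a * (-b / a ^ 2) + b * a⁻¹ = 0 by field_simp; ring] at hl
  have h1 := ((hr.tendsto.inv₀ ha).isBigO_one ℝ).mul (IsBigO.neg_left hl)
  refine h1.congr' ?_ (Eventually.of_forall fun n => one_mul _)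
  filter_upwards [hr.tendsto.eventually_ne ha] with n hn
  field_simp
  ring

/-- Factor the difference of squares; the sum r n + (a + b/n) is eventually at least a/2. -/
lemma of_sq (hr : Expands (fun n => r n ^ 2) (a ^ 2) (2 * a * b)) (ha : 0 < a)
    (h0 : ∀ᶠ n in atTop, 0 ≤ r n) : Expands r a b := by
  have hl := (linear a b).mul (linear a b)
  have h1 : (fun n : ℕ => r n ^ 2 - (a + b / n) ^ 2) =O[atTop] fun n : ℕ => ((n : ℝ) ^ 2)⁻¹ :=
    (IsBigO.sub hr hl).congr_left fun n => by ring
  refine IsBigO.trans (IsBigO.of_bound (2 / a) ?_) h1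
  filter_upwards [h0, (tendsto_linear a b).eventually (lt_mem_nhds (half_lt_self ha))]
    with n hn hn'
  rw [Real.norm_eq_abs, Real.norm_eq_abs, sq_sub_sq, abs_mul, div_mul_eq_mul_div,
    le_div_iff₀ ha, abs_of_pos (by linarith : 0 < r n + (a + b / n))]
  nlinarith [abs_nonneg (r n - (a + b / n))]

lemma squeeze {l u : ℕ → ℝ} (hl : Expands l a b) (hu : Expands u a b)
    (hlr : ∀ᶠ n in atTop, l n ≤ r n) (hru : ∀ᶠ n in atTop, r n ≤ u n) : Expands r a b := by
  refine IsBigO.trans (IsBigO.of_bound 1 ?_) (IsBigO.add (IsBigO.norm_left hl) (IsBigO.norm_left hu))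
  filter_upwards [hlr, hru] with n h1 h2
  rw [one_mul]
  refine le_trans ?_ (le_abs_self _)
  simp only [Real.norm_eq_abs]
  rw [abs_le]
  have h3 := neg_abs_le (l n - (a + b / n))
  have h4 := le_abs_self (u n - (a + b / n))
  have h5 := abs_nonneg (l n - (a + b / n))
  have h6 := abs_nonneg (u n - (a + b / n))
  constructor <;> linarith

lemma one_add_div_add_div_sq (p q t : ℝ) :
    Expands (fun n : ℕ => 1 + p / n + q / (n : ℝ) ^ 2 + t / (n : ℝ) ^ 3) 1 p := by
  have h3 : (fun n : ℕ => t / (n : ℝ) ^ 3) =O[atTop] fun n : ℕ => ((n : ℝ) ^ 2)⁻¹ := by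
    refine IsBigO.of_bound |t| ?_
    filter_upwards [eventually_ge_atTop 1] with n hn
    have hn' : (1 : ℝ) ≤ n := by exact_mod_cast hn
    rw [norm_div, Real.norm_eq_abs, div_eq_mul_inv, ← norm_inv]
    refine mul_le_mul_of_nonneg_left ?_ (abs_nonneg t)
    rw [Real.norm_of_nonneg (by positivity), Real.norm_of_nonneg (by positivity)]
    exact inv_anti₀ (by positivity) (pow_le_pow_right₀ hn' (by norm_num))
  have h2 : (fun n : ℕ => q / (n : ℝ) ^ 2) =O[atTop] fun n : ℕ => ((n : ℝ) ^ 2)⁻¹ :=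
    (isBigO_refl _ _).const_mul_left q
  refine of_isBigO ((h2.add h3).congr_left fun n => ?_) (linear 1 p)
  ring

lemma shift (hr : Expands r a b) : Expands (fun n => r (n + 1)) a b := by
  have hO : (fun n : ℕ => (((n + 1 : ℕ) : ℝ) ^ 2)⁻¹) =O[atTop]
      fun n : ℕ => ((n : ℝ) ^ 2)⁻¹ := by
    refine IsBigO.of_bound 1 ?_
    filter_upwards [eventually_ge_atTop 1] with n hn
    have hn' : (1 : ℝ) ≤ n := by exact_mod_cast hn
    rw [one_mul, Real.norm_of_nonneg (by positivity), Real.norm_of_nonneg (by positivity)]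
    refine inv_anti₀ (by positivity) ?_
    push_cast
    gcongr
    linarith
  have h1 := (hr.comp_tendsto (tendsto_add_atTop_nat 1)).trans hO
  refine of_isBigO h1 ?_
  have h2 : (fun n : ℕ => b / ((n + 1 : ℕ) : ℝ) - b / n) =O[atTop]
      fun n : ℕ => ((n : ℝ) ^ 2)⁻¹ := by
    refine IsBigO.of_bound |b| ?_
    filter_upwards [eventually_ge_atTop 1] with n hn
    have hn' : (1 : ℝ) ≤ n := by exact_mod_cast hn
    have e : b / ((n + 1 : ℕ) : ℝ) - b / n = -b * ((n : ℝ) * (n + 1))⁻¹ := by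
      push_cast
      field_simp
      ring
    rw [e, norm_mul, norm_neg, Real.norm_eq_abs]
    refine mul_le_mul_of_nonneg_left ?_ (abs_nonneg b)
    rw [Real.norm_of_nonneg (by positivity), Real.norm_of_nonneg (by positivity)]
    refine inv_anti₀ (by positivity) ?_
    nlinarith
  refine of_isBigO (h2.congr_left fun n => ?_) (linear a b)
  simp

end Expands

/-- The weight `(27 / 4) ^ n / n ^ (3 / 2)`. -/
noncomputable def weight (n : ℕ) : ℝ := (27 / 4) ^ n / (n : ℝ) ^ (3 / 2 : ℝ)

lemma weight_pos {n : ℕ} (hn : 1 ≤ n) : 0 < weight n := by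
  have : (0 : ℝ) < n := by exact_mod_cast hn
  unfold weight
  positivity

lemma rpow_three_halves_sq {x : ℝ} (hx : 0 ≤ x) : (x ^ (3 / 2 : ℝ)) ^ 2 = x ^ 3 := by
  rw [← Real.rpow_natCast, ← Real.rpow_mul hx, ← Real.rpow_natCast]
  norm_num

lemma weight_sq (n : ℕ) : weight n ^ 2 = ((27 / 4) ^ n) ^ 2 / (n : ℝ) ^ 3 := by
  rw [weight, div_pow, rpow_three_halves_sq (Nat.cast_nonneg n)]

/-- `f n = (27 / 4) ^ n / n ^ (3 / 2) * (a + b / n + O(1 / n ^ 2))`. -/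
def WeightedExpands (f : ℕ → ℝ) (a b : ℝ) : Prop := Expands (fun n => f n / weight n) a b

lemma expands_weight_ratio :
    Expands (fun n => weight (n + 1) / weight n) (27 / 4) (-(81 / 8)) := by
  -- The squared ratio is (27/4)^2 / (1 + 1/n)^3, which is rational in n.
  have h := ((Expands.one_add_div_add_div_sq 3 3 1).inv one_ne_zero).const_mul ((27 / 4) ^ 2)
  refine Expands.of_sq ?_ (by norm_num) ?_
  · have h' := h.congr' (s := fun n => (weight (n + 1) / weight n) ^ 2) ?_
    · convert h' using 1 <;> norm_num
    · filter_upwards [eventually_ge_atTop 1] with n hn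
      have hn' : (1 : ℝ) ≤ n := by exact_mod_cast hn
      rw [div_pow (weight _), weight_sq, weight_sq]
      push_cast
      field_simp
      ring
  · filter_upwards [eventually_ge_atTop 1] with n hn
    exact (div_pos (weight_pos (by omega)) (weight_pos hn)).le

namespace WeightedExpands

variable {f g : ℕ → ℝ} {a b c d : ℝ}

lemma add (hf : WeightedExpands f a b) (hg : WeightedExpands g c d) :
    WeightedExpands (fun n => f n + g n) (a + c) (b + d) :=
  (Expands.add hf hg).congr' (Eventually.of_forall fun n => by ring)

lemma sub (hf : WeightedExpands f a b) (hg : WeightedExpands g c d) :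
    WeightedExpands (fun n => f n - g n) (a - c) (b - d) :=
  (Expands.sub hf hg).congr' (Eventually.of_forall fun n => by ring)

lemma const_mul (hf : WeightedExpands f a b) (c : ℝ) :
    WeightedExpands (fun n => c * f n) (c * a) (c * b) :=
  (Expands.const_mul hf c).congr' (Eventually.of_forall fun n => by ring)

lemma shift (hf : WeightedExpands f a b) :
    WeightedExpands (fun n => f (n + 1)) (27 / 4 * a) (27 / 4 * (b - 3 / 2 * a)) := by
  have h := (Expands.shift hf).mul expands_weight_ratio
  have h' := h.congr' (s := fun n => f (n + 1) / weight n) ?_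
  · unfold WeightedExpands
    convert h' using 1 <;> ring
  · filter_upwards [eventually_ge_atTop 1] with n hn
    have h1 := (weight_pos hn).ne'
    have h2 := (weight_pos (n := n + 1) (by omega)).ne'
    field_simp

end WeightedExpands
end FibTree

/-! ### Asymptotics of the coefficients of T^3 -/

namespace FibTree
open Filter Asymptotics Topology Nat

lemma ternary_mul_factorial (k n : ℕ) :
    ternary (k + 1) n * (n ! * (2 * n + k + 1)! : ℝ) = (k + 1) * ((3 * n + k)! : ℝ) := by
  cases n with
  | zero =>
    simp only [ternary, mul_zero, zero_add, Nat.factorial_succ]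
    push_cast
    simp
  | succ n =>
    have h1 : ((3 * n + 3 + k + 1 : ℕ) : ℝ) * ((3 * n + 3 + k).choose n : ℝ) =
        ((3 * n + 3 + k + 1).choose (n + 1) : ℝ) * ((n + 1 : ℕ) : ℝ) := by
      exact_mod_cast Nat.add_one_mul_choose_eq (3 * n + 3 + k) n
    have h2 := Nat.choose_mul_factorial_mul_factorial (show n ≤ 3 * n + 3 + k by omega)
    rw [show 3 * n + 3 + k - n = 2 * (n + 1) + k + 1 by omega] at h2
    have h3 : ((3 * n + 3 + k).choose n : ℝ) * n ! * ((2 * (n + 1) + k + 1)! : ℝ) =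
      ((3 * n + 3 + k)! : ℝ) := by exact_mod_cast h2
    rw [ternary, show 3 * n + 3 + (k + 1) = 3 * n + 3 + k + 1 by ring,
      show 3 * n + 2 + (k + 1) = 3 * n + 3 + k by ring, show 3 * (n + 1) + k = 3 * n + 3 + k by ring,
      Nat.factorial_succ n, ← h3]
    push_cast at h1 ⊢
    linear_combination (-(n ! : ℝ) * ((2 * (n + 1) + k + 1)! : ℝ)) * h1

lemma ternary_succ_pos (k n : ℕ) : 0 < ternary (k + 1) n := by
  have h := ternary_mul_factorial k n
  by_contra hn
  have h1 : (0 : ℝ) < n ! * (2 * n + k + 1)! := by positivity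
  have h2 : (0 : ℝ) < (k + 1) * ((3 * n + k)! : ℝ) := by positivity
  nlinarith

lemma ternary_four (n : ℕ) : ternary 4 n * (n + 2) = 2 * (n + 1) * ternary 3 n := by
  have h3 := ternary_mul_factorial 2 n
  have h4 := ternary_mul_factorial 3 n
  rw [show 2 * n + 3 + 1 = 2 * n + 2 + 1 + 1 by ring, Nat.factorial_succ (2 * n + 2 + 1),
    show 3 * n + 3 = 3 * n + 2 + 1 by ring, Nat.factorial_succ (3 * n + 2)] at h4
  have hp : (n ! * (2 * n + 2 + 1)! : ℝ) ≠ 0 := by positivity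
  refine mul_right_cancel₀ hp ?_
  push_cast at *
  linear_combination (1 / 2) * h4 - 2 * (n + 1) * h3

lemma ternary_three_ratio (n : ℕ) :
    ternary 3 (n + 1) * ((2 * n + 5) * (2 * n + 4)) =
      3 * (3 * n + 5) * (3 * n + 4) * ternary 3 n := by
  have h3 := ternary_mul_factorial 2 n
  have h4 := ternary_mul_factorial 2 (n + 1)
  rw [show 2 * (n + 1) + 2 + 1 = 2 * n + 2 + 1 + 1 + 1 by ring,
    Nat.factorial_succ (2 * n + 2 + 1 + 1), Nat.factorial_succ (2 * n + 2 + 1),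
    show 3 * (n + 1) + 2 = 3 * n + 2 + 1 + 1 + 1 by ring, Nat.factorial_succ (3 * n + 2 + 1 + 1),
    Nat.factorial_succ (3 * n + 2 + 1), Nat.factorial_succ (3 * n + 2), Nat.factorial_succ n] at h4
  have hp : ((n + 1) * (n ! * (2 * n + 2 + 1)!) : ℝ) ≠ 0 := by positivity
  refine mul_right_cancel₀ hp ?_
  push_cast at *
  linear_combination h4 - 3 * (3 * n + 5) * (3 * n + 4) * (n + 1) * h3

/-- The square of the normalised coefficient `[x ^ n] T ^ 3 / (27 / 4) ^ n`. -/
noncomputable def normSq (n : ℕ) : ℝ := (ternary 3 n / (27 / 4) ^ n) ^ 2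

lemma normSq_nonneg (n : ℕ) : 0 ≤ normSq n := sq_nonneg _

lemma normSq_succ (n : ℕ) :
    normSq (n + 1) * (81 * (2 * n + 5) ^ 2 * (2 * n + 4) ^ 2) =
      16 * (3 * n + 5) ^ 2 * (3 * n + 4) ^ 2 * normSq n := by
  have h : ternary 3 (n + 1) =
      3 * (3 * n + 5) * (3 * n + 4) * ternary 3 n / ((2 * n + 5) * (2 * n + 4)) :=
    (eq_div_iff (by positivity)).2 (ternary_three_ratio n)
  rw [normSq, normSq, h, pow_succ]
  field_simp
  ring

/-- Squaring turns n^(3/2) into n^3, so consecutive ratios are rational. The value 151/36 is the one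
that cancels the 1/n^2 term of the ratio of consecutive products. -/
lemma normSq_mul_monotone :
    Monotone fun n : ℕ => normSq n * ((n : ℝ) ^ 3 + 151 / 36 * (n : ℝ) ^ 2) := by
  refine monotone_nat_of_le_succ fun n => ?_
  have hp : (0 : ℝ) < 81 * (2 * n + 5) ^ 2 * (2 * n + 4) ^ 2 := by positivity
  have key : 0 ≤ 16 * (3 * n + 5) ^ 2 * (3 * n + 4) ^ 2 * ((n + 1 : ℝ) ^ 3 + 151 / 36 * (n + 1 : ℝ) ^ 2) -
      81 * (2 * n + 5) ^ 2 * (2 * n + 4) ^ 2 * ((n : ℝ) ^ 3 + 151 / 36 * (n : ℝ) ^ 2) := by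
    ring_nf
    positivity
  refine le_of_mul_le_mul_right ?_ hp
  push_cast
  linear_combination mul_nonneg (normSq_nonneg n) key -
    ((n + 1 : ℝ) ^ 3 + 151 / 36 * (n + 1 : ℝ) ^ 2) * normSq_succ n

/-- The lower-order terms 10 n + 5 reverse the monotonicity; they are large enough that the
polynomial difference expands with nonnegative coefficients. -/
lemma normSq_mul_antitone :
    Antitone fun n : ℕ => normSq n * ((n : ℝ) ^ 3 + 151 / 36 * (n : ℝ) ^ 2 + 10 * (n : ℝ) + 5) := by
  refine antitone_nat_of_succ_le fun n => ?_
  have hp : (0 : ℝ) < 81 * (2 * n + 5) ^ 2 * (2 * n + 4) ^ 2 := by positivity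
  have key : 0 ≤ 81 * (2 * n + 5) ^ 2 * (2 * n + 4) ^ 2 * ((n : ℝ) ^ 3 + 151 / 36 * (n : ℝ) ^ 2 + 10 * (n : ℝ) + 5) -
      16 * (3 * n + 5) ^ 2 * (3 * n + 4) ^ 2 * ((n + 1 : ℝ) ^ 3 + 151 / 36 * (n + 1 : ℝ) ^ 2 + 10 * (n + 1 : ℝ) + 5) := by
    ring_nf
    positivity
  refine le_of_mul_le_mul_right ?_ hp
  push_cast
  linear_combination mul_nonneg (normSq_nonneg n) key +
    ((n + 1 : ℝ) ^ 3 + 151 / 36 * (n + 1 : ℝ) ^ 2 + 10 * (n + 1 : ℝ) + 5) * normSq_succ n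

lemma factorial_sq_eq {n : ℕ} (hn : 1 ≤ n) :
    (n ! : ℝ) ^ 2 = Stirling.stirlingSeq n ^ 2 * (2 * n) * ((n / Real.exp 1) ^ n) ^ 2 := by
  have hn' : (0 : ℝ) < n := by exact_mod_cast hn
  have h : (n ! : ℝ) =
      Stirling.stirlingSeq n * (√(2 * n) * (n / Real.exp 1) ^ n) := by
    rw [Stirling.stirlingSeq, div_mul_cancel₀]
    positivity
  rw [h, mul_pow, mul_pow, Real.sq_sqrt (by positivity)]
  ring

lemma trinomial_sq_eq {n : ℕ} (hn : 1 ≤ n) :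
    (((3 * n)! : ℝ) / (n ! * (2 * n)!) / (27 / 4) ^ n) ^ 2 * n =
      3 / 4 * (Stirling.stirlingSeq (3 * n) ^ 2 /
        (Stirling.stirlingSeq n ^ 2 * Stirling.stirlingSeq (2 * n) ^ 2)) := by
  have hn' : (0 : ℝ) < n := by exact_mod_cast hn
  have hS : ∀ m : ℕ, 1 ≤ m → Stirling.stirlingSeq m ≠ 0 := fun m hm => by
    obtain ⟨m, rfl⟩ := Nat.exists_eq_add_of_le' hm
    exact (Stirling.stirlingSeq'_pos m).ne'
  have h1 := hS n hn
  have h2 := hS (2 * n) (by omega)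
  rw [div_pow, div_pow, mul_pow, factorial_sq_eq hn, factorial_sq_eq (n := 2 * n) (by omega),
    factorial_sq_eq (n := 3 * n) (by omega)]
  have e3 : (((3 * n : ℕ) : ℝ) / Real.exp 1) ^ (3 * n) =
      27 ^ n * ((n / Real.exp 1) ^ n) ^ 3 := by
    rw [← pow_mul, mul_comm n 3, pow_mul, pow_mul, ← mul_pow]
    congr 1
    push_cast
    ring
  have e2 : (((2 * n : ℕ) : ℝ) / Real.exp 1) ^ (2 * n) =
      4 ^ n * ((n / Real.exp 1) ^ n) ^ 2 := by
    rw [← pow_mul, mul_comm n 2, pow_mul, pow_mul, ← mul_pow]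
    congr 1
    push_cast
    ring
  have hE : ((n : ℝ) / Real.exp 1) ^ n ≠ 0 := by positivity
  rw [e3, e2, div_pow 27 (4 : ℝ)]
  generalize ((n : ℝ) / Real.exp 1) ^ n = y at *
  push_cast
  field_simp
  ring

/-- Stirling for n!, (2n)! and (3n)!, times the rational factor relating `ternary 3 n` to the
trinomial quotient. -/
lemma tendsto_normSq_mul_cube :
    Tendsto (fun n : ℕ => normSq n * (n : ℝ) ^ 3) atTop (𝓝 (2187 / (256 * Real.pi))) := by
  have hS := Stirling.tendsto_stirlingSeq_sqrt_pi
  have hm : ∀ c : ℕ, 1 ≤ c → Tendsto (fun n => Stirling.stirlingSeq (c * n) ^ 2) atTop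
      (𝓝 (√Real.pi ^ 2)) := fun c hc =>
    (hS.comp (tendsto_id.const_mul_atTop' (by omega : 0 < c))).pow 2
  have h1 := (((hm 3 (by norm_num)).div ((hS.pow 2).mul (hm 2 (by norm_num)))
    (by positivity)).const_mul (3 / 4))
  have hl := Expands.tendsto_linear
  have h2 := ((((hl 3 2).mul (hl 3 1)).const_mul 3).div (((hl 2 3).mul (hl 2 2)).mul (hl 2 1))
    (by norm_num)).pow 2
  have h3 := h1.mul h2
  rw [Real.sq_sqrt Real.pi_pos.le] at h3
  have hlim : (3 : ℝ) / 4 * (Real.pi / (Real.pi * Real.pi)) * (3 * (3 * 3) / (2 * 2 * 2)) ^ 2 =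
      2187 / (256 * Real.pi) := by
    field_simp
    norm_num
  rw [hlim] at h3
  refine h3.congr' ?_
  filter_upwards [eventually_ge_atTop 1] with n hn
  have hn' : (0 : ℝ) < n := by exact_mod_cast hn
  have ht := ternary_mul_factorial 2 n
  rw [Nat.factorial_succ (2 * n + 2), Nat.factorial_succ (2 * n + 1), Nat.factorial_succ (2 * n),
    Nat.factorial_succ (3 * n + 1), Nat.factorial_succ (3 * n)] at ht
  have e : ternary 3 n = 3 * ((3 * n + 2) * (3 * n + 1)) /
      ((2 * n + 3) * (2 * n + 2) * (2 * n + 1)) * (((3 * n)! : ℝ) / (n ! * (2 * n)!)) := by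
    push_cast at ht
    rw [_root_.div_mul_div_comm, eq_div_iff (by positivity)]
    linear_combination ht
  simp only [Pi.div_apply]
  rw [← trinomial_sq_eq hn, normSq, e]
  field_simp

/-- The increasing and the decreasing product share the limit L, so L bounds one above and the other
below; the two bounds agree up to O(1/n^2). -/
lemma expands_normSq_mul_cube :
    Expands (fun n => normSq n * (n : ℝ) ^ 3) (2187 / (256 * Real.pi))
      (2187 / (256 * Real.pi) * (-(151 / 36))) := by
  set L := 2187 / (256 * Real.pi) with hL
  have hQ : ∀ q t : ℝ, Tendsto (fun n : ℕ =>
      normSq n * ((n : ℝ) ^ 3 + 151 / 36 * (n : ℝ) ^ 2 + q * n + t)) atTop (𝓝 L) := by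
    intro q t
    have h := tendsto_normSq_mul_cube.mul (Expands.one_add_div_add_div_sq (151 / 36) q t).tendsto
    rw [mul_one] at h
    refine h.congr' ?_
    filter_upwards [eventually_ge_atTop 1] with n hn
    have hn' : (0 : ℝ) < n := by exact_mod_cast hn
    field_simp
  have hE : ∀ q t : ℝ, Expands (fun n : ℕ => L * (1 + 151 / 36 / n + q / (n : ℝ) ^ 2 +
      t / (n : ℝ) ^ 3)⁻¹) L (L * (-(151 / 36))) := by
    intro q t
    have h := ((Expands.one_add_div_add_div_sq (151 / 36) q t).inv one_ne_zero).const_mul L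
    simpa using h
  refine Expands.squeeze (hE 10 5) (hE 0 0) ?_ ?_
  · filter_upwards [eventually_ge_atTop 1] with n hn
    have hn' : (0 : ℝ) < n := by exact_mod_cast hn
    have h := normSq_mul_antitone.le_of_tendsto (hQ 10 5) n
    rw [← div_eq_mul_inv, div_le_iff₀ (by positivity)]
    refine h.trans (le_of_eq ?_)
    field_simp
  · filter_upwards [eventually_ge_atTop 1] with n hn
    have hn' : (0 : ℝ) < n := by exact_mod_cast hn
    have h := normSq_mul_monotone.ge_of_tendsto ((hQ 0 0).congr fun n => by ring) n
    rw [← div_eq_mul_inv, le_div_iff₀ (by positivity)]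
    refine (le_of_eq ?_).trans h
    field_simp
    ring

/-- The leading constant in the asymptotics of `[x ^ n] T ^ 3`. -/
noncomputable def leadConst : ℝ := 81 / (16 * √(3 * Real.pi))

lemma leadConst_pos : 0 < leadConst := by unfold leadConst; positivity

lemma leadConst_sq : leadConst ^ 2 = 2187 / (256 * Real.pi) := by
  rw [leadConst, div_pow, mul_pow, Real.sq_sqrt (by positivity)]
  field_simp
  norm_num

lemma ternary_three_expands :
    WeightedExpands (ternary 3) leadConst (leadConst * (-(151 / 72))) := by
  refine Expands.of_sq ?_ leadConst_pos ?_
  · rw [leadConst_sq, show 2 * leadConst * (leadConst * (-(151 / 72))) =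
      leadConst ^ 2 * (-(151 / 36)) by ring, leadConst_sq]
    refine expands_normSq_mul_cube.congr' ?_
    filter_upwards [eventually_ge_atTop 1] with n hn
    have hn' : (0 : ℝ) < n := by exact_mod_cast hn
    rw [div_pow, weight_sq, normSq]
    field_simp
  · filter_upwards [eventually_ge_atTop 1] with n hn
    exact (div_pos (ternary_succ_pos 2 n) (weight_pos hn)).le

lemma ternary_four_expands :
    WeightedExpands (ternary 4) (2 * leadConst)
      (2 * (leadConst * (-(151 / 72))) - 2 * leadConst) := by
  have h := (ternary_three_expands.const_mul 2 : Expands _ _ _).mul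
    ((Expands.linear 1 1).mul ((Expands.linear 1 2).inv one_ne_zero))
  have h' := h.congr' (s := fun n => ternary 4 n / weight n) ?_
  · unfold WeightedExpands
    convert h' using 1 <;> ring
  · filter_upwards [eventually_ge_atTop 1] with n hn
    have hn' : (0 : ℝ) < n := by exact_mod_cast hn
    have hw := (weight_pos hn).ne'
    rw [(eq_div_iff (by positivity)).2 (ternary_four n)]
    field_simp

/-- Solve for d(n) in terms of d(n+1) and iterate forward. Each iteration scales the a priori bound
by (27/4)/8 = 27/32, and the errors sum to (1/8) / (1 - 27/32) = 4/5. -/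
lemma abs_le_of_recurrence {d g : ℕ → ℝ} {K K' : ℝ} {N : ℕ} (hK : 0 ≤ K)
    (hg : ∀ n, N ≤ n → g (n + 1) ≤ g n) (hd : ∀ n, N ≤ n → |d n| ≤ K' * (27 / 4) ^ n)
    (hr : ∀ n, N ≤ n → |8 * d n - d (n + 1)| ≤ K * g n * (27 / 4) ^ n) {n : ℕ} (hn : N ≤ n)
    (hg0 : ∀ n, N ≤ n → 0 ≤ g n) :
    |d n| ≤ 4 / 5 * K * g n * (27 / 4) ^ n := by
  have key : ∀ m n, N ≤ n →
      |d n| ≤ ((27 / 32) ^ m * K' + 4 / 5 * K * g n) * (27 / 4) ^ n := by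
    intro m
    induction m with
    | zero =>
      intro n hn
      have h1 := hd n hn
      have h2 := hg0 n hn
      have h3 : 0 ≤ 4 / 5 * K * g n * (27 / 4) ^ n := by positivity
      linarith
    | succ m ih =>
      intro n hn
      have h1 := ih (n + 1) (by omega)
      have h2 := hr n hn
      have h3 : 8 * |d n| ≤ |8 * d n - d (n + 1)| + |d (n + 1)| := by
        have := abs_add_le (8 * d n - d (n + 1)) (d (n + 1))
        rwa [sub_add_cancel, abs_mul, abs_of_pos (by norm_num : (0 : ℝ) < 8)] at this
      have h4 : K * g (n + 1) * (27 / 4) ^ n ≤ K * g n * (27 / 4) ^ n := by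
        have := hg n hn
        gcongr
      rw [pow_succ] at h1 ⊢
      linarith
  have hlim : Tendsto (fun m : ℕ => ((27 / 32) ^ m * K' + 4 / 5 * K * g n) * (27 / 4) ^ n) atTop
      (𝓝 ((0 * K' + 4 / 5 * K * g n) * (27 / 4) ^ n)) :=
    (((tendsto_pow_atTop_nhds_zero_of_lt_one (by norm_num) (by norm_num)).mul_const _).add_const
      _).mul_const _
  have := ge_of_tendsto' hlim fun m => key m n hn
  linarith

end FibTree

/-! ### Transfer through the recurrences and conclusion -/

namespace FibTree
open Filter Asymptotics Topology

lemma expands_zero_iff {r : ℕ → ℝ} :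
    Expands r 0 0 ↔ r =O[atTop] fun n : ℕ => ((n : ℝ) ^ 2)⁻¹ := by
  simp [Expands]

lemma WeightedExpands.of_recurrence {f h : ℕ → ℝ} {a b K : ℝ}
    (hrec : ∀ n, f (n + 1) = 8 * f n - h n) (hf : ∀ n, |f n| ≤ K * (27 / 4) ^ n)
    (hh : WeightedExpands h a b) :
    WeightedExpands f (4 / 5 * a) (4 / 5 * (b - 81 / 8 * (4 / 5 * a))) := by
  set α := 4 / 5 * a with hα
  set β := 4 / 5 * (b - 81 / 8 * α) with hβ
  -- Approximate solution: α and β are chosen so that 8 p(n) - p(n+1) matches both terms of the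
  -- expansion of h.
  set p : ℕ → ℝ := fun n => weight n * (α + β / n) with hp
  have hpE : WeightedExpands p α β := by
    refine (Expands.linear α β).congr' ?_
    filter_upwards [eventually_ge_atTop 1] with n hn
    rw [hp, mul_div_cancel_left₀ _ (weight_pos hn).ne']
  have hE := hh.sub ((hpE.const_mul 8).sub hpE.shift)
  rw [show a - (8 * α - 27 / 4 * α) = 0 by rw [hα]; ring,
    show b - (8 * β - 27 / 4 * (β - 3 / 2 * α)) = 0 by rw [hβ]; ring] at hE
  obtain ⟨C, hC0, hC⟩ := (expands_zero_iff.1 hE).exists_pos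
  rw [IsBigOWith_def] at hC
  obtain ⟨N, hN⟩ := eventually_atTop.1 (hC.and (eventually_ge_atTop 1))
  set g : ℕ → ℝ := fun n => ((n : ℝ) ^ (3 / 2 : ℝ))⁻¹ * ((n : ℝ) ^ 2)⁻¹ with hg
  have hwg : ∀ n : ℕ, weight n * ((n : ℝ) ^ 2)⁻¹ = g n * (27 / 4) ^ n := fun n => by
    rw [weight, hg]; ring
  have h1 : ∀ n, N ≤ n → (1 : ℝ) ≤ n := fun n hn => by exact_mod_cast (hN n hn).2
  have hd : ∀ n, N ≤ n → |f n - p n| ≤ (K + (|α| + |β|)) * (27 / 4) ^ n := by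
    intro n hn
    have hn1 := h1 n hn
    have hw : weight n ≤ (27 / 4) ^ n :=
      div_le_self (by positivity) (Real.one_le_rpow hn1 (by norm_num))
    have hab : |α + β / n| ≤ |α| + |β| := by
      refine (abs_add_le _ _).trans (add_le_add_right ?_ _)
      rw [abs_div, Nat.abs_cast]
      exact div_le_self (abs_nonneg _) hn1
    have hpn : |p n| ≤ (27 / 4) ^ n * (|α| + |β|) := by
      rw [hp, abs_mul, abs_of_pos (weight_pos (hN n hn).2)]
      gcongr
    have := abs_sub (f n) (p n)
    linarith [hf n]
  have hr : ∀ n, N ≤ n →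
      |8 * (f n - p n) - (f (n + 1) - p (n + 1))| ≤ C * g n * (27 / 4) ^ n := by
    intro n hn
    have h := (hN n hn).1
    have hw := weight_pos (hN n hn).2
    rw [Real.norm_eq_abs, Real.norm_of_nonneg (by positivity), abs_div, abs_of_pos hw,
      div_le_iff₀ hw, mul_assoc, mul_comm _ (weight n), hwg, ← mul_assoc] at h
    rw [hrec]
    exact le_of_eq_of_le (congrArg abs (by ring)) h
  have hganti : ∀ n, N ≤ n → g (n + 1) ≤ g n := by
    intro n hn
    have := h1 n hn
    simp only [hg, Nat.cast_add, Nat.cast_one]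
    gcongr <;> linarith
  have hmain : (fun n => (f n - p n) / weight n) =O[atTop] fun n : ℕ => ((n : ℝ) ^ 2)⁻¹ := by
    refine IsBigO.of_bound (4 / 5 * C) ?_
    filter_upwards [eventually_ge_atTop N] with n hn
    have hw := weight_pos (hN n hn).2
    have := abs_le_of_recurrence hC0.le hganti hd hr hn fun n _ => by positivity
    rw [Real.norm_eq_abs, Real.norm_of_nonneg (by positivity), abs_div, abs_of_pos hw,
      div_le_iff₀ hw, mul_assoc, mul_comm _ (weight n), hwg, ← mul_assoc]
    exact this
  refine Expands.of_isBigO (s := fun n => p n / weight n)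
    (hmain.congr_left fun n => by ring) hpE

lemma abs_doublePole_le (n k : ℕ) : |doublePole k n| ≤ (3 / 2) ^ k * (27 / 4) ^ n := by
  rw [abs_of_nonneg (doublePole_bounds n k).1, mul_comm]
  exact (doublePole_bounds n k).2

lemma simplePole_zero_expands :
    WeightedExpands (simplePole 0) (4 * leadConst)
      (leadConst * (4 * (-(151 / 72)) - 34)) := by
  have h := WeightedExpands.of_recurrence (f := simplePole 0)
    (h := fun n => 3 * ternary 3 n + ternary 4 n) (K := 2 + 3 / 2)
    (fun n => by rw [simplePole_zero_succ]; ring) (fun n => ?_)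
    ((ternary_three_expands.const_mul 3).add ternary_four_expands)
  · convert h using 1 <;> ring
  -- The a priori bound comes from writing the simple pole as 2 `doublePole 0` - `doublePole 1`.
  · have h0 := abs_doublePole_le n 0
    have h1 := abs_doublePole_le n 1
    have := abs_sub (2 * doublePole 0 n) (doublePole 1 n)
    rw [abs_mul, abs_two] at this
    rw [show simplePole 0 n = 2 * doublePole 0 n - doublePole 1 n by rw [doublePole_one]; ring]
    linarith

lemma doublePole_zero_expands :
    WeightedExpands (doublePole 0) (12 * leadConst) (12 * leadConst * (-1387 / 72)) := by
  have h := WeightedExpands.of_recurrence (f := doublePole 0)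
    (h := fun n => 4 * simplePole 0 n - ternary 3 n)
    (fun n => by rw [doublePole_zero_succ]; ring) (abs_doublePole_le · 0)
    ((simplePole_zero_expands.const_mul 4).sub ternary_three_expands)
  convert h using 1 <;> ring

lemma t_pos (k : ℕ) : 0 < t k := by
  unfold t
  split_ifs <;> positivity

lemma t_add_three (k : ℕ) :
    t (k + 3) = (if k % 3 = 2 then 27 / 4 else 1) * t (k + 1) - t k := by
  have h3 : k % 3 = 0 ∨ k % 3 = 1 ∨ k % 3 = 2 := by omega
  have e : (k + 3) / 3 = k / 3 + 1 := by omega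
  unfold t
  rw [e]
  rcases h3 with h | h | h
  · rw [show (k + 1) / 3 = k / 3 by omega]
    simp only [show (k + 3) % 3 = 0 by omega, show (k + 1) % 3 = 1 by omega, h]
    norm_num
    ring
  · rw [show (k + 1) / 3 = k / 3 by omega]
    simp only [show (k + 3) % 3 = 1 by omega, show (k + 1) % 3 = 2 by omega, h]
    norm_num
    ring
  · rw [show (k + 1) / 3 = k / 3 + 1 by omega]
    simp only [show (k + 3) % 3 = 2 by omega, show (k + 1) % 3 = 0 by omega, h]
    norm_num
    ring

lemma t_mul_s_add_three (k : ℕ) :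
    t (k + 3) * s (k + 3) =
      (if k % 3 = 2 then 27 / 4 * t (k + 1) * (s (k + 1) - 3 / 2) else t (k + 1) * s (k + 1)) -
        t k * s k := by
  rw [s, Nat.add_mod_right]
  split_ifs <;> exact mul_div_cancel₀ _ (t_pos _).ne'

/-- Induction along `alignedCount_add_three`: the index shift accounts for the factor 27/4 and the
correction -3/2 in the recursions of `t` and `s`. -/
lemma alignedCount_expands (k : ℕ) :
    WeightedExpands (alignedCount k) (12 * leadConst * (t k : ℝ))
      (12 * leadConst * ((t k * s k : ℚ) : ℝ)) := by
  induction k using Nat.strong_induction_on with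
  | _ k ih =>
    match k with
    | 0 =>
      rw [funext (alignedCount_of_lt (k := 0) (by norm_num))]
      convert doublePole_zero_expands using 1 <;> norm_num [t, s]
    | 1 =>
      rw [funext (alignedCount_of_lt (k := 1) (by norm_num)), funext doublePole_one]
      convert (doublePole_zero_expands.const_mul 2).sub simplePole_zero_expands using 1 <;>
        norm_num [t, s] <;> ring
    | 2 =>
      rw [funext (alignedCount_of_lt (k := 2) (by norm_num)), funext doublePole_two]
      convert ((doublePole_zero_expands.const_mul 4).sub
        (simplePole_zero_expands.const_mul 4)).add ternary_three_expands using 1 <;>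
        norm_num [t, s] <;> ring
    | k + 3 =>
      have h0 := ih k (by omega)
      have h1 := ih (k + 1) (by omega)
      rw [t_mul_s_add_three, t_add_three, funext (alignedCount_add_three k)]
      split_ifs
      · convert h1.shift.sub h0 using 1 <;> push_cast <;> ring
      · convert h1.sub h0 using 1 <;> push_cast <;> ring

lemma WeightedExpands.bound {f : ℕ → ℝ} {a b : ℝ} (h : WeightedExpands f a b) :
    ∃ K : ℝ, 0 < K ∧ ∀ n : ℕ, 1 ≤ n →
      |f n - (a * (27 / 4) ^ n / (n : ℝ) ^ (3 / 2 : ℝ) +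
        b * (27 / 4) ^ n / (n : ℝ) ^ (5 / 2 : ℝ))| ≤
        K * ((27 / 4 : ℝ) ^ n / (n : ℝ) ^ (7 / 2 : ℝ)) := by
  obtain ⟨K, hK, hb⟩ := bound_of_isBigO_nat_atTop h
  refine ⟨K, hK, fun n hn => ?_⟩
  have hn' : (0 : ℝ) < n := by exact_mod_cast hn
  have hw := weight_pos hn
  have e5 : (n : ℝ) ^ (5 / 2 : ℝ) = (n : ℝ) ^ (3 / 2 : ℝ) * n := by
    rw [← Real.rpow_add_one hn'.ne']; norm_num
  have e7 : (n : ℝ) ^ (7 / 2 : ℝ) = (n : ℝ) ^ (3 / 2 : ℝ) * (n : ℝ) ^ 2 := by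
    rw [← Real.rpow_natCast, ← Real.rpow_add hn']; norm_num
  have hbn := hb (x := n) (by positivity)
  rw [Real.norm_eq_abs, Real.norm_of_nonneg (by positivity)] at hbn
  have e : f n - (a * (27 / 4) ^ n / (n : ℝ) ^ (3 / 2 : ℝ) +
      b * (27 / 4) ^ n / (n : ℝ) ^ (5 / 2 : ℝ)) =
      weight n * (f n / weight n - (a + b / n)) := by
    rw [mul_sub, mul_div_cancel₀ _ hw.ne', weight, e5]
    field_simp
  rw [e, abs_mul, abs_of_pos hw, e7, ← div_div, ← weight]
  calc weight n * |f n / weight n - (a + b / n)|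
      ≤ weight n * (K * ((n : ℝ) ^ 2)⁻¹) := by gcongr
    _ = K * (weight n / (n : ℝ) ^ 2) := by ring

lemma twelve_mul_leadConst : 12 * leadConst = 243 / (4 * √(3 * Real.pi)) := by
  unfold leadConst
  ring

end FibTree

theorem theorem3 :
    ∀ k : ℕ, ∃ K : ℝ, 0 < K ∧
      ∀ a b : ℕ, Nat.Coprime a b → FibTree.shortestWalk (1, 1) (a, b) = k →
        ∃ (C : ℝ) (D : ℚ), 0 < C ∧
          (1 ≤ a → 1 ≤ b →
            C = 243 * (FibTree.t k : ℝ) / (4 * Real.sqrt (3 * Real.pi)) ∧ D = FibTree.s k) ∧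
          ∀ n : ℕ, 1 ≤ n →
            |(FibTree.A a b n : ℝ) -
                (C * (27 / 4 : ℝ) ^ n / (n : ℝ) ^ (3 / 2 : ℝ) +
                  C * (D : ℝ) * (27 / 4 : ℝ) ^ n / (n : ℝ) ^ (5 / 2 : ℝ))| ≤
              K * ((27 / 4 : ℝ) ^ n / (n : ℝ) ^ (7 / 2 : ℝ)) := by
  intro k
  have hC := FibTree.leadConst_pos
  have ht : (0 : ℝ) < FibTree.t k := by exact_mod_cast FibTree.t_pos k
  obtain ⟨K₁, hK₁, h₁⟩ := (FibTree.alignedCount_expands k).bound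
  obtain ⟨K₂, hK₂, h₂⟩ := FibTree.doublePole_zero_expands.bound
  obtain ⟨K₃, hK₃, h₃⟩ := (FibTree.doublePole_zero_expands.const_mul 2).bound
  -- One constant serves all pairs with this k: K₁ for positive pairs, K₂ for (1,0) and K₃ for
  -- (0,1).
  refine ⟨K₁ + K₂ + K₃, by positivity, fun a b hab hk => ?_⟩
  rcases Nat.eq_zero_or_pos a with rfl | ha
  · obtain rfl : b = 1 := by simpa using hab
    refine ⟨2 * (12 * FibTree.leadConst), -1387 / 72, by positivity, fun h => by omega,
      fun n hn => ?_⟩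
    rw [FibTree.A_zero_one]
    refine le_trans (le_of_eq_of_le ?_ (h₃ n hn)) ?_
    · push_cast
      ring_nf
    · gcongr
      linarith
  rcases Nat.eq_zero_or_pos b with rfl | hb
  · obtain rfl : a = 1 := by simpa using hab
    refine ⟨12 * FibTree.leadConst, -1387 / 72, by positivity, fun _ h => by omega,
      fun n hn => ?_⟩
    rw [FibTree.A_one_zero]
    refine le_trans (le_of_eq_of_le ?_ (h₂ n hn)) ?_
    · push_cast
      rfl
    · gcongr
      linarith
  obtain ⟨l, hl⟩ := FibTree.exists_atDepth ha hb hab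
  obtain rfl : l = k := (FibTree.shortestWalk_eq hl).symm.trans hk
  refine ⟨12 * FibTree.leadConst * FibTree.t l, FibTree.s l, by positivity, fun _ _ => ⟨?_, rfl⟩,
    fun n hn => ?_⟩
  · rw [FibTree.twelve_mul_leadConst]
    ring
  · rw [FibTree.A_eq_alignedCount hl]
    refine le_trans (le_of_eq_of_le ?_ (h₁ n hn)) ?_
    · push_cast
      ring_nf
    · gcongr
      linarith
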